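/- Let $T_u,T_u',\hat\delta\ge 1$ and $T_p\ge 0$ be integers, $C_u,C_p,\omega\ge 0$ real numbers and $p_s\in(0,1]$. Consider the following semi-Markov decision process (a device sending status updates). The state is the age $s\in\mathcal S=\{1,\dots,\hat\delta\}$, and the actions are $\mathcal A=\{(0,0),(0,1),(1,1)\}$ (idle; sample and transmit; sample, preprocess and transmit), with durations $L=1,\ T_u,\ T_p+T_u'$, transmission times $L_u=0,\ T_u,\ T_u'$ and energies $C=0,\ T_uC_u,\ T_pC_p+T_u'C_u$, respectively. Under $(0,0)$ the state moves from $s$ to $\min(s+1,\hat\delta)$; under an updating action $\boldsymbol a\ne(0,0)$ it moves to $\min(L(\boldsymbol a),\hat\delta)$ with probability $p_s^{L_u(\boldsymbol a)}$ and to $\min(s+L(\boldsymbol a),\hat\delta)$ otherwise; this defines $p(s'\mid s,\boldsymbol a)$. The cost of a step is $R(s,\boldsymbol a)=\sum_{i=1}^{L(\boldsymbol a)}(s+i-1)+\omega C(\boldsymbol a)$. The average cost of a stationary deterministic policy $\pi:\mathcal S\to\mathcal A$ from a state $s(1)$ is $\limsup_{T\to\infty}\mathbb E[\sum_{t=1}^T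 R(s(t),\pi(s(t)))]/\mathbb E[\sum_{t=1}^T L(\pi(s(t)))]$. A policy is unichain if its Markov chain has a single recurrent class. For $0<\epsilon\le\min_{\boldsymbol a}L(\boldsymbol a)$ and $V:\mathcal S\to\mathbb R$ put $$Q_V(s,\boldsymbol a)=\frac{R(s,\boldsymbol a)}{L(\boldsymbol a)}+\frac{\epsilon}{L(\boldsymbol a)}\sum_{s'\in\mathcal S}p(s'\mid s,\boldsymbol a)V(s')+\Big(1-\frac{\epsilon}{L(\boldsymbol a)}\Big)V(s).$$ A pair $(\theta,V)$ solves the Bellman equation if $\theta+V(s)=\min_{\boldsymbol a\in\mathcal A}Q_V(s,\boldsymbol a)$ for all $s\in\mathcal S$, and $\pi$ is greedy for $V$ if $\pi(s)\in\arg\min_{\boldsymbol a}Q_V(s,\boldsymbol a)$ for all $s\in\mathcal S$. Let $\mathcal S^\dagger=\{s\in\mathcal S: s\ge\min(T_u,T_p+T_u')\}$. **Theorem.** Let $p_s=1$ (reliable channel), let $\boldsymbol a_1,\boldsymbol a_2$ be the two updating actions, labelled so that $L(\boldsymbol a_1)\le L(\boldsymbol a_2)$, suppose that $\frac{C(\boldsymbol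 a_1)}{L(\boldsymbol a_1)}\le\frac{C(\boldsymbol a_2)}{L(\boldsymbol a_2)}$, and let $0<\epsilon\le\min_{\boldsymbol a}L(\boldsymbol a)$. Call a policy $\pi$ of switch type if there is an integer $\Omega\ge\min(T_u,T_p+T_u')=L(\boldsymbol a_1)$ such that for all $s\in\mathcal S^\dagger$ $$\pi(s)=\begin{cases}(0,0),& L(\boldsymbol a_1)\le s<\Omega,\\ \boldsymbol a_1,& s\ge\Omega.\end{cases}$$ (If $\Omega>\hat\delta$, the policy idles on all of $\mathcal S^\dagger$.) 1. For every solution $(\theta,V)$ of the Bellman equation: $Q_V(s,\boldsymbol a_1)\le Q_V(s,\boldsymbol a_2)$ for all $s\in\mathcal S^\dagger$, with strict inequality if $L(\boldsymbol a_1)<L(\boldsymbol a_2)$. Moreover, every unichain policy $\pi$ that is greedy for $V$ attains, from every initial state, the least average cost among all stationary deterministic policies; it satisfies $\pi(s)\ne\boldsymbol a_2$ on $\mathcal S^\dagger$ if $L(\boldsymbol a_1)<L(\boldsymbol a_2)$; and it is of switch type whenever $\pi(s)\neq\boldsymbol a_2$ on $\mathcal S^\dagger$ (so always, if $L(\boldsymbol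 a_1)<L(\boldsymbol a_2)$). 2. Such policies exist: there are a solution $(\theta,V)$ of the Bellman equation and a unichain policy that is greedy for $V$, attains the least average cost among all stationary deterministic policies from every initial state, has average cost $\theta$ from every initial state, and is of switch type. -/

import Mathlib

/-! Age-of-information status updating with optional preprocessing, as a semi-Markov decision
process with finitely many ages, its average cost, and its uniformized Bellman equation. -/

namespace StatusUpdate

/-- Parameters of the system. `Tu`: minislots needed to send a raw update; `TuPost`: minislots
needed to send a preprocessed update; `Tp`: minislots needed for preprocessing; `Cu`, `Cp`:
energy per minislot of communication and computation; `omega`: weighting factor; `ps`: success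
probability of one packet; `maxAge`: upper limit of the age. -/
structure Model where
  Tu : ℕ
  TuPost : ℕ
  Tp : ℕ
  Cu : ℝ
  Cp : ℝ
  omega : ℝ
  ps : ℝ
  maxAge : ℕ
  Tu_pos : 0 < Tu
  TuPost_pos : 0 < TuPost
  Cu_nonneg : 0 ≤ Cu
  Cp_nonneg : 0 ≤ Cp
  omega_nonneg : 0 ≤ omega
  ps_pos : 0 < ps
  ps_le_one : ps ≤ 1
  maxAge_pos : 0 < maxAge

/-- The control actions: `idle` is (0,0), `direct` is (0,1) (sample and transmit), `preprocess`
is (1,1) (sample, preprocess, transmit). -/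
inductive Action where
  | idle
  | direct
  | preprocess
  deriving DecidableEq

namespace Model

variable (M : Model)

/-- States: the ages `1, …, maxAge`. -/
abbrev State : Type := ↥(Finset.Icc 1 M.maxAge)

/-- Duration of an action, in minislots. -/
def dur : Action → ℕ
  | .idle => 1
  | .direct => M.Tu
  | .preprocess => M.Tp + M.TuPost

/-- Transmission time of an action, in minislots. -/
def txDur : Action → ℕ
  | .idle => 0
  | .direct => M.Tu
  | .preprocess => M.TuPost

/-- Energy spent by an action. -/
def energy : Action → ℝ
  | .idle => 0
  | .direct => M.Tu * M.Cu
  | .preprocess => M.Tp * M.Cp + M.TuPost * M.Cu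

/-- Transition probability from age `s` to age `s'` under an action: idling lets the age grow by
one; an update succeeds with probability `ps ^ txDur`, which resets the age to the duration of
the action, and otherwise the age grows by this duration; ages are truncated at `maxAge`. -/
noncomputable def trans (s : M.State) (a : Action) (s' : M.State) : ℝ :=
  match a with
  | .idle => if (s' : ℕ) = min ((s : ℕ) + 1) M.maxAge then 1 else 0
  | a =>
      M.ps ^ M.txDur a * (if (s' : ℕ) = min (M.dur a) M.maxAge then 1 else 0) +
      (1 - M.ps ^ M.txDur a) * (if (s' : ℕ) = min ((s : ℕ) + M.dur a) M.maxAge then 1 else 0)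

/-- Cost of one time step: the ages `s, s + 1, …` over its minislots, plus weighted energy. -/
noncomputable def cost (s : M.State) (a : Action) : ℝ :=
  ∑ i ∈ Finset.range (M.dur a), (((s : ℕ) : ℝ) + (i : ℝ)) + M.omega * M.energy a

/-- Stationary deterministic policies. -/
abbrev Policy : Type := M.State → Action

/-- Transition matrix of the Markov chain induced by a policy. -/
noncomputable def chain (π : M.Policy) : Matrix M.State M.State ℝ :=
  Matrix.of fun s s' => M.trans s (π s) s'

/-- Expected total cost of the first `T` time steps from the initial state `s`. -/
noncomputable def expCost (π : M.Policy) (T : ℕ) (s : M.State) : ℝ :=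
  ∑ t ∈ Finset.range T, ((M.chain π ^ t).mulVec fun x => M.cost x (π x)) s

/-- Expected total duration of the first `T` time steps from the initial state `s`. -/
noncomputable def expDur (π : M.Policy) (T : ℕ) (s : M.State) : ℝ :=
  ∑ t ∈ Finset.range T, ((M.chain π ^ t).mulVec fun x => (M.dur (π x) : ℝ)) s

/-- Long-run average cost per minislot. -/
noncomputable def avgCost (π : M.Policy) (s : M.State) : ℝ :=
  Filter.limsup (fun T : ℕ => M.expCost π T s / M.expDur π T s) Filter.atTop

/-- The policy attains the least average cost among all stationary deterministic policies, from
every initial state. -/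
def IsAvgOptimal (π : M.Policy) : Prop :=
  ∀ (π' : M.Policy) (s : M.State), M.avgCost π s ≤ M.avgCost π' s

/-- `s'` can be reached from `s` with positive probability. -/
def Reach (π : M.Policy) (s s' : M.State) : Prop :=
  ∃ n : ℕ, 0 < (M.chain π ^ n) s s'

/-- Recurrent states of the (finite) chain: those that can be reached back from every state
reachable from them. -/
def IsRecurrent (π : M.Policy) (s : M.State) : Prop :=
  ∀ s', M.Reach π s s' → M.Reach π s' s

/-- Unichain policies: there is a single recurrent class. -/
def IsUnichain (π : M.Policy) : Prop :=
  ∀ s s', M.IsRecurrent π s → M.IsRecurrent π s' → M.Reach π s s'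

/-- Cost of the uniformized decision process. -/
noncomputable def ucost (s : M.State) (a : Action) : ℝ :=
  M.cost s a / (M.dur a : ℝ)

/-- Transition probabilities of the uniformized decision process with parameter `ε`: the
original transition is made with probability `ε / dur a`, else the state is kept. -/
noncomputable def utrans (ε : ℝ) (s : M.State) (a : Action) (s' : M.State) : ℝ :=
  ε / (M.dur a : ℝ) * M.trans s a s' + if s' = s then 1 - ε / (M.dur a : ℝ) else 0

/-- State-action value with respect to `V`. -/
noncomputable def qval (ε : ℝ) (V : M.State → ℝ) (s : M.State) (a : Action) : ℝ :=
  M.ucost s a + ∑ s' : M.State, M.utrans ε s a s' * V s'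

/-- `θ + V s = min over a of qval s a` for every state `s`. -/
def IsBellmanSolution (ε θ : ℝ) (V : M.State → ℝ) : Prop :=
  ∀ s : M.State, IsLeast (Set.range (M.qval ε V s)) (θ + V s)

/-- The policy takes, in every state, an action that minimizes the state-action value. -/
def IsGreedy (ε : ℝ) (V : M.State → ℝ) (π : M.Policy) : Prop :=
  ∀ (s : M.State) (a : Action), M.qval ε V s (π s) ≤ M.qval ε V s a

/-- The reduced state space: ages not below the shorter of the two update durations. -/
def reducedStates : Set M.State :=
  {s | min M.Tu (M.Tp + M.TuPost) ≤ (s : ℕ)}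

/-- On the reduced state space the policy idles below some threshold `Ω`, which is at least
the shorter update duration, and takes the action `a` from `Ω` on. (No age reaches `Ω` if `Ω`
exceeds `maxAge`.) -/
def IsSwitchType (a : Action) (π : M.Policy) : Prop :=
  ∃ Ω : ℕ, min M.Tu (M.Tp + M.TuPost) ≤ Ω ∧
    ∀ s ∈ M.reducedStates,
      ((s : ℕ) < Ω → π s = Action.idle) ∧ (Ω ≤ (s : ℕ) → π s = a)

end Model

end StatusUpdate

namespace StatusUpdate

namespace Model

variable (M : Model)

/-! With a reliable channel every step is deterministic. Putting `w = ε * V` removes the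
uniformization: the Bellman equation says that `excess` is nonnegative and vanishes for some action
in each state, and greedy means zero excess (`isBellmanSolution_iff`, `isGreedy_iff`).

Since an update leads to an age independent of the present one, `w` is nondecreasing
(`relValue_mono`). Per minislot, the shorter update then costs no more energy, ages no more during
the action, and gains at least as large a drop of `w` in no more time (`excess_div_add_le`).

Along a trajectory the excesses telescope (`expCost_sub_expDur`), so `θ` bounds every average cost
from below and greedy policies attain it.

For the switch form, suppose a greedy policy updates at `n` and idles at `n + 1`. The slopes of `w`
force it to idle up to the maximal age, which becomes absorbing, while a lower update cycle is also
closed; a unichain policy excludes this (`isSwitchType_of_excess`).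

For existence, `θ` is the least average cost among the cycles "idle up to `s`, then update" and
idling forever at the top; `w` is written down explicitly above the post-update age and by recursion
below it (`exists_relValue`). -/

lemma dur_pos (a : Action) : 0 < M.dur a := by
  have := M.Tu_pos
  have := M.TuPost_pos
  cases a <;> simp only [dur] <;> omega

lemma one_le_dur (a : Action) : (1 : ℝ) ≤ M.dur a := by
  exact_mod_cast M.dur_pos a

/-! ### Deterministic transitions and the excess form of the Bellman equation -/

/-- The part of the cost of a step that does not depend on the age. -/
noncomputable def fixedCost (a : Action) : ℝ :=
  (M.dur a : ℝ) * ((M.dur a : ℝ) - 1) / 2 + M.omega * M.energy a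

lemma fixedCost_idle : M.fixedCost .idle = 0 := by
  simp [fixedCost, dur, energy]

lemma cost_eq (s : M.State) (a : Action) :
    M.cost s a = M.dur a * ((s : ℕ) : ℝ) + M.fixedCost a := by
  have key : ∀ (n : ℕ) (x : ℝ),
      ∑ i ∈ Finset.range n, (x + (i : ℝ)) = n * x + n * ((n : ℝ) - 1) / 2 := by
    intro n x
    induction n with
    | zero => simp
    | succ n ih => rw [Finset.sum_range_succ, ih]; push_cast; ring
  rw [cost, key, fixedCost]
  ring

/-- The age that follows a successful step. -/
def nextAge (s : ℕ) : Action → ℕ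
  | .idle => min (s + 1) M.maxAge
  | a => min (M.dur a) M.maxAge

lemma nextAge_of_ne_idle (s : ℕ) {a : Action} (ha : a ≠ .idle) :
    M.nextAge s a = min (M.dur a) M.maxAge := by
  cases a <;> simp_all [nextAge]

lemma nextAge_mem (s : ℕ) (a : Action) : M.nextAge s a ∈ Finset.Icc 1 M.maxAge := by
  have := M.maxAge_pos
  have := M.dur_pos a
  rw [Finset.mem_Icc]
  cases a <;> simp only [nextAge] <;> omega

/-- The state that follows a successful step. -/
def next (s : M.State) (a : Action) : M.State :=
  ⟨M.nextAge s a, M.nextAge_mem s a⟩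

lemma trans_eq_ite (hps : M.ps = 1) (s : M.State) (a : Action) (s' : M.State) :
    M.trans s a s' = if s' = M.next s a then 1 else 0 := by
  cases a <;> simp [trans, next, nextAge, hps, Subtype.ext_iff]

/-- The excess of taking the action `a` at age `s` over the optimal relative value, in the
optimality equation `w s = min over a of (dur a * (s - θ) + fixedCost a + w (nextAge s a))`. -/
noncomputable def excess (θ : ℝ) (w : ℕ → ℝ) (s : ℕ) (a : Action) : ℝ :=
  M.dur a * ((s : ℝ) - θ) + M.fixedCost a + w (M.nextAge s a) - w s

lemma excess_idle (θ : ℝ) (w : ℕ → ℝ) (s : ℕ) :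
    M.excess θ w s .idle = s - θ + w (min (s + 1) M.maxAge) - w s := by
  simp [excess, fixedCost_idle, nextAge, dur]

lemma excess_of_ne_idle (θ : ℝ) (w : ℕ → ℝ) (s : ℕ) {a : Action} (ha : a ≠ .idle) :
    M.excess θ w s a =
      M.dur a * ((s : ℝ) - θ) + M.fixedCost a + w (min (M.dur a) M.maxAge) - w s := by
  rw [excess, nextAge_of_ne_idle M s ha]

lemma qval_eq (hps : M.ps = 1) (ε θ : ℝ) (V : M.State → ℝ) (w : ℕ → ℝ)
    (hw : ∀ s : M.State, w s = ε * V s) (s : M.State) (a : Action) :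
    M.qval ε V s a = θ + V s + M.excess θ w s a / M.dur a := by
  have hd : (M.dur a : ℝ) ≠ 0 := by exact_mod_cast (M.dur_pos a).ne'
  have hn : w (M.nextAge s a) = ε * V (M.next s a) := hw (M.next s a)
  have hsum : ∑ s' : M.State, M.utrans ε s a s' * V s' =
      ε / (M.dur a : ℝ) * V (M.next s a) + (1 - ε / (M.dur a : ℝ)) * V s := by
    simp [utrans, trans_eq_ite M hps, add_mul, Finset.sum_add_distrib, ite_mul]
  rw [qval, hsum, ucost, cost_eq, excess, hn, hw s]
  field_simp
  ring

/-- Extension of a function of the state to all natural numbers. -/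
noncomputable def ageExtend (f : M.State → ℝ) (n : ℕ) : ℝ :=
  if h : n ∈ Finset.Icc 1 M.maxAge then f ⟨n, h⟩ else 0

lemma ageExtend_coe (f : M.State → ℝ) (s : M.State) : M.ageExtend f s = f s := by
  unfold ageExtend
  rw [dif_pos s.2]

lemma isBellmanSolution_iff (hps : M.ps = 1) (ε θ : ℝ) (V : M.State → ℝ) (w : ℕ → ℝ)
    (hw : ∀ s : M.State, w s = ε * V s) :
    M.IsBellmanSolution ε θ V ↔
      ∀ s : M.State, (∀ a, 0 ≤ M.excess θ w s a) ∧ ∃ a, M.excess θ w s a = 0 := by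
  have hd : ∀ a, (0 : ℝ) < M.dur a := fun a => by exact_mod_cast M.dur_pos a
  refine forall_congr' fun s => ?_
  constructor
  · rintro ⟨⟨a, ha⟩, hle⟩
    refine ⟨fun b => ?_, a, ?_⟩
    · have h := hle ⟨b, rfl⟩
      rw [qval_eq M hps ε θ V w hw] at h
      by_contra hneg
      have := div_neg_of_neg_of_pos (not_le.mp hneg) (hd b)
      linarith
    · rw [qval_eq M hps ε θ V w hw] at ha
      have h0 : M.excess θ w s a / M.dur a = 0 := by linarith
      exact (div_eq_zero_iff.mp h0).resolve_right (hd a).ne'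
  · rintro ⟨hle, a, ha⟩
    refine ⟨⟨a, ?_⟩, ?_⟩
    · rw [qval_eq M hps ε θ V w hw, ha]
      simp
    · rintro _ ⟨b, rfl⟩
      rw [qval_eq M hps ε θ V w hw]
      have := div_nonneg (hle b) (hd b).le
      linarith

lemma isGreedy_iff (hps : M.ps = 1) (ε θ : ℝ) (V : M.State → ℝ) (w : ℕ → ℝ)
    (hw : ∀ s : M.State, w s = ε * V s) (hV : M.IsBellmanSolution ε θ V) (π : M.Policy) :
    M.IsGreedy ε V π ↔ ∀ s : M.State, M.excess θ w s (π s) = 0 := by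
  have hd : ∀ a, (0 : ℝ) < M.dur a := fun a => by exact_mod_cast M.dur_pos a
  have hB := (isBellmanSolution_iff M hps ε θ V w hw).mp hV
  refine forall_congr' fun s => ?_
  constructor
  · intro h
    obtain ⟨b, hb⟩ := (hB s).2
    have h1 := h b
    rw [qval_eq M hps ε θ V w hw, qval_eq M hps ε θ V w hw, hb] at h1
    by_contra hne
    have := div_pos (lt_of_le_of_ne ((hB s).1 (π s)) (Ne.symm hne)) (hd (π s))
    simp only [zero_div] at h1
    linarith
  · intro h a
    rw [qval_eq M hps ε θ V w hw, qval_eq M hps ε θ V w hw, h]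
    have := div_nonneg ((hB s).1 a) (hd a).le
    simp only [zero_div]
    linarith

/-! ### Comparing the updates; monotone relative values -/

/-- The shorter update is at least as good as the longer one, provided that the relative value
after it is at most the present one and the one after the longer update. -/
lemma excess_div_add_le {a₁ a₂ : Action} (hL : M.dur a₁ ≤ M.dur a₂)
    (hC : M.energy a₁ / (M.dur a₁ : ℝ) ≤ M.energy a₂ / (M.dur a₂ : ℝ))
    (θ : ℝ) (w : ℕ → ℝ) (s : ℕ)
    (hs : w (M.nextAge s a₁) ≤ w s) (hn : w (M.nextAge s a₁) ≤ w (M.nextAge s a₂)) :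
    M.excess θ w s a₁ / M.dur a₁ + ((M.dur a₂ : ℝ) - M.dur a₁) / 2
      ≤ M.excess θ w s a₂ / M.dur a₂ := by
  have h1 := M.one_le_dur a₁
  have h2 := M.one_le_dur a₂
  have hL' : (M.dur a₁ : ℝ) ≤ M.dur a₂ := by exact_mod_cast hL
  have hform : ∀ a, M.excess θ w s a / M.dur a = s - θ + ((M.dur a : ℝ) - 1) / 2 +
      M.omega * (M.energy a / M.dur a) + (w (M.nextAge s a) - w s) / M.dur a := by
    intro a
    -- The term `(dur a - 1) / 2` is the mean ageing during the action; it yields the gap in the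
    -- statement.
    have hd : (M.dur a : ℝ) ≠ 0 := by exact_mod_cast (M.dur_pos a).ne'
    unfold excess fixedCost
    field_simp
    ring
  have hE := mul_le_mul_of_nonneg_left hC M.omega_nonneg
  have hW : (w (M.nextAge s a₁) - w s) / M.dur a₁ ≤ (w (M.nextAge s a₂) - w s) / M.dur a₂ := by
    rw [div_le_div_iff₀ (by linarith) (by linarith)]
    nlinarith [mul_nonneg (sub_nonneg.mpr hs) (sub_nonneg.mpr hL'),
      mul_nonneg (sub_nonneg.mpr hn) (zero_le_one.trans h1)]
  rw [hform, hform]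
  linarith

/-- Relative values that solve the optimality equation increase with the age. -/
lemma relValue_le_succ (θ : ℝ) (w : ℕ → ℝ)
    (hw : ∀ s ∈ Finset.Icc 1 M.maxAge,
      (∀ a, 0 ≤ M.excess θ w s a) ∧ ∃ a, M.excess θ w s a = 0)
    {s : ℕ} (hs : 1 ≤ s) (hsm : s + 1 ≤ M.maxAge) : w s ≤ w (s + 1) := by
  -- Induction downwards from the maximal age. An action optimal at `s + 1` is tried at `s`: an
  -- update gives a slope of at least its duration, idling gives 1 plus the next slope.
  induction h : M.maxAge - (s + 1) generalizing s with
  | zero | succ k ih =>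
    obtain ⟨a, ha⟩ := (hw (s + 1) (Finset.mem_Icc.mpr ⟨by omega, hsm⟩)).2
    have hle := (hw s (Finset.mem_Icc.mpr ⟨hs, by omega⟩)).1
    by_cases hidle : a = .idle
    · subst hidle
      have h0 := hle .idle
      rw [excess_idle] at h0 ha
      rw [min_eq_left hsm] at h0
      push_cast at ha
      -- The first alternative is the maximal age, where idling keeps the state and the next slope
      -- is 0.
      first
      | rw [min_eq_right (by omega), show M.maxAge = s + 1 by omega] at ha
        linarith
      | rw [min_eq_left (by omega)] at ha
        have := ih (s := s + 1) (by omega) (by omega) (by omega)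
        linarith
    · have h0 := hle a
      rw [excess_of_ne_idle M θ w _ hidle] at h0 ha
      have := M.one_le_dur a
      push_cast at ha
      linarith

lemma relValue_mono (θ : ℝ) (w : ℕ → ℝ)
    (hw : ∀ s ∈ Finset.Icc 1 M.maxAge,
      (∀ a, 0 ≤ M.excess θ w s a) ∧ ∃ a, M.excess θ w s a = 0)
    {s t : ℕ} (hs : 1 ≤ s) (hst : s ≤ t) (htm : t ≤ M.maxAge) : w s ≤ w t := by
  induction t, hst using Nat.le_induction with
  | base => exact le_rfl
  | succ t hst ih =>
    exact (ih (by omega)).trans (relValue_le_succ M θ w hw (by omega) htm)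

/-! ### Orbits and reachability -/

/-- The transition map of a policy when every update succeeds. -/
def step (π : M.Policy) (s : M.State) : M.State :=
  M.next s (π s)

lemma chain_pow_mulVec (hps : M.ps = 1) (π : M.Policy) (n : ℕ) (f : M.State → ℝ) :
    ((M.chain π ^ n).mulVec f) = fun s => f ((M.step π)^[n] s) := by
  induction n with
  | zero => simp
  | succ n ih =>
    rw [pow_succ', ← Matrix.mulVec_mulVec, ih]
    funext s
    simp [Matrix.mulVec, dotProduct, chain, trans_eq_ite M hps, step]

lemma chain_pow_apply (hps : M.ps = 1) (π : M.Policy) (n : ℕ) (s s' : M.State) :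
    (M.chain π ^ n) s s' = if (M.step π)^[n] s = s' then 1 else 0 := by
  have h := congrFun (chain_pow_mulVec M hps π n (Pi.single s' 1)) s
  rw [Matrix.mulVec_single_one] at h
  simpa [Matrix.col_apply, Pi.single_apply] using h

lemma reach_iff (hps : M.ps = 1) (π : M.Policy) (s s' : M.State) :
    M.Reach π s s' ↔ ∃ n, (M.step π)^[n] s = s' := by
  refine exists_congr fun n => ?_
  rw [chain_pow_apply M hps]
  split_ifs with h <;> simp [h]

lemma Reach.trans (hps : M.ps = 1) {π : M.Policy} {s t u : M.State}
    (h : M.Reach π s t) (h' : M.Reach π t u) : M.Reach π s u := by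
  rw [reach_iff M hps] at *
  obtain ⟨n, rfl⟩ := h
  obtain ⟨k, rfl⟩ := h'
  exact ⟨k + n, Function.iterate_add_apply _ _ _ _⟩

lemma reach_refl (hps : M.ps = 1) (π : M.Policy) (s : M.State) : M.Reach π s s :=
  (reach_iff M hps π s s).mpr ⟨0, rfl⟩

lemma reach_step (hps : M.ps = 1) (π : M.Policy) (s : M.State) :
    M.Reach π s (M.step π s) :=
  (reach_iff M hps π s _).mpr ⟨1, rfl⟩

/-- A recurrent `s'` reaches `r`, so by recurrence `r` reaches `s'`; every other state gets there
through `r`. -/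
lemma isUnichain_of_reach (hps : M.ps = 1) (π : M.Policy) (r : M.State)
    (h : ∀ s, M.Reach π s r) : M.IsUnichain π :=
  fun s s' _ hs' => Reach.trans M hps (h s) (hs' r (h s'))

lemma mem_of_reach (hps : M.ps = 1) (π : M.Policy) (A : Set M.State)
    (hA : ∀ s ∈ A, M.step π s ∈ A) {s t : M.State} (hs : s ∈ A) (h : M.Reach π s t) :
    t ∈ A := by
  obtain ⟨n, rfl⟩ := (reach_iff M hps π s t).mp h
  exact (show Set.MapsTo (M.step π) A A from hA).iterate n hs

lemma step_coe_of_idle (π : M.Policy) {s : M.State} (h : π s = .idle) :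
    (M.step π s : ℕ) = min ((s : ℕ) + 1) M.maxAge := by
  simp [step, next, nextAge, h]

lemma step_coe_of_ne_idle (π : M.Policy) {s : M.State} (h : π s ≠ .idle) :
    (M.step π s : ℕ) = min (M.dur (π s)) M.maxAge :=
  nextAge_of_ne_idle M s h

lemma reach_of_idle (hps : M.ps = 1) (π : M.Policy) {s t : M.State} (hst : (s : ℕ) ≤ t)
    (h : ∀ x : M.State, (s : ℕ) ≤ x → (x : ℕ) < t → π x = .idle) : M.Reach π s t := by
  induction hk : (t : ℕ) - s generalizing s with
  | zero =>
    rw [show s = t from Subtype.ext (by omega)]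
    exact reach_refl M hps π t
  | succ k ih =>
    have ht := Finset.mem_Icc.mp t.2
    have hs : (M.step π s : ℕ) = s + 1 := by
      rw [step_coe_of_idle M π (h s le_rfl (by omega))]
      omega
    exact Reach.trans M hps (reach_step M hps π s)
      (ih (by omega) (fun x hx hxt => h x (by omega) hxt) (by omega))


/-! ### Average cost by telescoping -/

lemma expCost_eq (hps : M.ps = 1) (π : M.Policy) (T : ℕ) (s : M.State) :
    M.expCost π T s =
      ∑ t ∈ Finset.range T, M.cost ((M.step π)^[t] s) (π ((M.step π)^[t] s)) := by
  simp only [expCost, chain_pow_mulVec M hps]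

lemma expDur_eq (hps : M.ps = 1) (π : M.Policy) (T : ℕ) (s : M.State) :
    M.expDur π T s = ∑ t ∈ Finset.range T, (M.dur (π ((M.step π)^[t] s)) : ℝ) := by
  simp only [expDur, chain_pow_mulVec M hps]

lemma le_expDur (hps : M.ps = 1) (π : M.Policy) (T : ℕ) (s : M.State) :
    (T : ℝ) ≤ M.expDur π T s := by
  rw [expDur_eq M hps]
  have := Finset.card_nsmul_le_sum (Finset.range T)
    (fun t => (M.dur (π ((M.step π)^[t] s)) : ℝ)) 1 (fun t _ => M.one_le_dur _)
  simpa using this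

lemma expCost_sub_expDur (hps : M.ps = 1) (π : M.Policy) (θ : ℝ) (w : ℕ → ℝ) (T : ℕ)
    (s : M.State) :
    M.expCost π T s - θ * M.expDur π T s =
      w s - w ((M.step π)^[T] s) +
        ∑ t ∈ Finset.range T, M.excess θ w ((M.step π)^[t] s) (π ((M.step π)^[t] s)) := by
  rw [expCost_eq M hps, expDur_eq M hps]
  induction T with
  | zero => simp
  | succ T ih =>
    rw [Finset.sum_range_succ, Finset.sum_range_succ, Finset.sum_range_succ, cost_eq, excess,
      Function.iterate_succ_apply']
    change _ = w s - w (M.nextAge ((M.step π)^[T] s) (π ((M.step π)^[T] s))) + _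
    linarith

lemma exists_abs_sub_le (w : ℕ → ℝ) :
    ∃ B : ℝ, ∀ s t : M.State, |w s - w t| ≤ B := by
  obtain ⟨B, hB⟩ := (Set.finite_range fun p : M.State × M.State => |w p.1 - w p.2|).bddAbove
  exact ⟨B, fun s t => hB ⟨(s, t), rfl⟩⟩

/-- A real `limsup` is meaningful only for bounded sequences; this supplies the upper bound needed
in `le_avgCost`. -/
lemma exists_expCost_div_le (hps : M.ps = 1) (π : M.Policy) (s : M.State) :
    ∃ K : ℝ, ∀ T, M.expCost π T s / M.expDur π T s ≤ K := by
  obtain ⟨K, hK⟩ := (Set.finite_range fun x : M.State => M.cost x (π x)).bddAbove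
  refine ⟨max K 0, fun T => ?_⟩
  have hD := M.le_expDur hps π T s
  refine div_le_of_le_mul₀ ((Nat.cast_nonneg T).trans hD) (le_max_right _ _) ?_
  have h1 : M.expCost π T s ≤ T * max K 0 := by
    rw [expCost_eq M hps]
    have := Finset.sum_le_card_nsmul (Finset.range T)
      (fun t => M.cost ((M.step π)^[t] s) (π ((M.step π)^[t] s))) (max K 0)
      (fun t _ => (hK ⟨_, rfl⟩).trans (le_max_left _ _))
    simpa using this
  calc M.expCost π T s ≤ T * max K 0 := h1
    _ ≤ M.expDur π T s * max K 0 := by gcongr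
    _ = max K 0 * M.expDur π T s := mul_comm _ _

lemma tendsto_add_const_div (θ B : ℝ) :
    Filter.Tendsto (fun T : ℕ => θ + B / T) Filter.atTop (nhds θ) := by
  simpa using tendsto_const_nhds.add (tendsto_const_div_atTop_nhds_zero_nat B)

/-- A supersolution value `θ` of the optimality equation bounds the average cost of every policy
from below. -/
lemma le_avgCost (hps : M.ps = 1) (θ : ℝ) (w : ℕ → ℝ)
    (hw : ∀ (s : M.State) (a : Action), 0 ≤ M.excess θ w s a) (π : M.Policy) (s : M.State) :
    θ ≤ M.avgCost π s := by
  obtain ⟨B, hB⟩ := M.exists_abs_sub_le w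
  obtain ⟨K, hK⟩ := M.exists_expCost_div_le hps π s
  have hlim := tendsto_add_const_div θ (-B)
  rw [← hlim.limsup_eq]
  refine Filter.limsup_le_limsup ?_ hlim.isCoboundedUnder_le
    (Filter.isBoundedUnder_of ⟨K, hK⟩)
  filter_upwards [Filter.eventually_gt_atTop 0] with T hT
  have hT' : (0 : ℝ) < T := by exact_mod_cast hT
  have hD := M.le_expDur hps π T s
  have hD0 := hT'.trans_le hD
  have h := M.expCost_sub_expDur hps π θ w T s
  have hsum := Finset.sum_nonneg (s := Finset.range T)
    (fun t _ => hw ((M.step π)^[t] s) (π ((M.step π)^[t] s)))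
  have hb := hB s ((M.step π)^[T] s)
  have hb1 := neg_le_of_abs_le hb
  have hB0 : 0 ≤ B := (abs_nonneg _).trans hb
  have h1 : B / M.expDur π T s ≤ B / T := div_le_div_of_nonneg_left hB0 hT' hD
  have h2 : θ - B / M.expDur π T s ≤ M.expCost π T s / M.expDur π T s := by
    rw [le_div_iff₀ hD0, sub_mul, div_mul_cancel₀ _ hD0.ne']
    linarith
  rw [neg_div]
  linarith

lemma avgCost_eq (hps : M.ps = 1) (θ : ℝ) (w : ℕ → ℝ) (π : M.Policy)
    (hπ : ∀ s : M.State, M.excess θ w s (π s) = 0) (s : M.State) :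
    M.avgCost π s = θ := by
  obtain ⟨B, hB⟩ := M.exists_abs_sub_le w
  have hclose : ∀ T : ℕ, 0 < T →
      |M.expCost π T s / M.expDur π T s - θ| ≤ B / T := by
    intro T hT
    have hT' : (0 : ℝ) < T := by exact_mod_cast hT
    have hD := M.le_expDur hps π T s
    have hD0 := hT'.trans_le hD
    have h := M.expCost_sub_expDur hps π θ w T s
    rw [Finset.sum_eq_zero (fun t _ => hπ _), add_zero] at h
    have hb := hB s ((M.step π)^[T] s)
    rw [div_sub' hD0.ne', mul_comm, h, abs_div, abs_of_pos hD0]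
    exact div_le_div₀ ((abs_nonneg _).trans hb) hb hT' hD
  refine Filter.Tendsto.limsup_eq ?_
  have hlow := tendsto_add_const_div θ (-B)
  have hup := tendsto_add_const_div θ B
  refine tendsto_of_tendsto_of_tendsto_of_le_of_le' hlow hup ?_ ?_ <;>
    filter_upwards [Filter.eventually_gt_atTop 0] with T hT
  · have := neg_le_of_abs_le (hclose T hT)
    rw [neg_div]
    linarith
  · have := le_of_abs_le (hclose T hT)
    linarith

lemma isAvgOptimal_of_excess (hps : M.ps = 1) (θ : ℝ) (w : ℕ → ℝ)
    (hw : ∀ (s : M.State) (a : Action), 0 ≤ M.excess θ w s a) (π : M.Policy)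
    (hπ : ∀ s : M.State, M.excess θ w s (π s) = 0) : M.IsAvgOptimal π := by
  intro π' s
  rw [avgCost_eq M hps θ w π hπ]
  exact le_avgCost M hps θ w hw π' s

/-! ### Switch structure of greedy unichain policies -/

lemma min_dur_eq {a₁ a₂ : Action} (h₁ : a₁ ≠ .idle) (h₂ : a₂ ≠ .idle) (h₁₂ : a₁ ≠ a₂)
    (hL : M.dur a₁ ≤ M.dur a₂) : min M.Tu (M.Tp + M.TuPost) = M.dur a₁ := by
  cases a₁ <;> cases a₂ <;> simp_all [dur]

lemma eq_idle_or_eq_or_eq {a₁ a₂ : Action} (h₁ : a₁ ≠ .idle) (h₂ : a₂ ≠ .idle) (h₁₂ : a₁ ≠ a₂)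
    (a : Action) : a = .idle ∨ a = a₁ ∨ a = a₂ := by
  cases a <;> cases a₁ <;> cases a₂ <;> simp_all

/-- Once an optimal policy updates at age `Ω` and idles at age `Ω + 1`, idling up to age `j` makes
updating at age `j` strictly suboptimal. -/
lemma relValue_lt_of_idle {a : Action} (ha : a ≠ .idle) (θ : ℝ) (w : ℕ → ℝ)
    (hw : ∀ s ∈ Finset.Icc 1 M.maxAge, ∀ b, 0 ≤ M.excess θ w s b)
    {r j : ℕ} (hr : 1 ≤ r) (hupd : M.excess θ w r a = 0) (hj : r + 1 < j) (hjm : j ≤ M.maxAge)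
    (hidle : ∀ i, r < i → i < j → M.excess θ w i .idle = 0) :
    0 < M.excess θ w j a := by
  -- The slope of `w` from `r` to `r + 1` is at least `θ - r`, as idling at `r` is no better, and at
  -- most `dur a`, as updating at `r + 1` is no better.
  have hθ : θ - r ≤ M.dur a := by
    have h1 := hw r (Finset.mem_Icc.mpr ⟨hr, by omega⟩) .idle
    have h2 := hw (r + 1) (Finset.mem_Icc.mpr ⟨by omega, by omega⟩) a
    rw [excess_idle, min_eq_left (by omega)] at h1
    rw [excess_of_ne_idle M θ w _ ha] at h2 hupd
    push_cast at h2
    linarith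
  -- Idling at `i` makes the slope exactly `θ - i`, which is below `dur a`.
  have hstep : ∀ i, r < i → i < j → M.excess θ w i a < M.excess θ w (i + 1) a := by
    intro i hri hij
    have h1 := hidle i hri hij
    have hri' : (r : ℝ) < i := by exact_mod_cast hri
    rw [excess_idle, min_eq_left (by omega)] at h1
    rw [excess_of_ne_idle M θ w _ ha, excess_of_ne_idle M θ w _ ha]
    push_cast
    linarith
  obtain ⟨k, rfl⟩ : ∃ k, j = k + 1 := ⟨j - 1, by omega⟩
  exact (hw k (Finset.mem_Icc.mpr ⟨by omega, by omega⟩) a).trans_lt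
    (hstep k (by omega) (by omega))

/-- Two disjoint recurrent classes: the absorbing maximal age, and the cycle that idles up to `r`
and then updates. -/
lemma not_isUnichain_of_idle_of_update (hps : M.ps = 1) (π : M.Policy) {r top : M.State}
    (htop : (top : ℕ) = M.maxAge) (htop' : π top = .idle) (hr : π r ≠ .idle)
    (hrm : (r : ℕ) < top) (hdur : M.dur (π r) ≤ r)
    (hidle : ∀ s : M.State, M.dur (π r) ≤ s → (s : ℕ) < r → π s = .idle) :
    ¬ M.IsUnichain π := by
  intro huni
  have hreach_top : ∀ s, M.Reach π top s → s = top := by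
    refine fun s hs => mem_of_reach M hps π {top} ?_ rfl hs
    rintro _ rfl
    refine Subtype.ext ?_
    rw [step_coe_of_idle M π htop']
    omega
  have hreach_r : ∀ s, M.Reach π r s → M.dur (π r) ≤ s ∧ (s : ℕ) ≤ r := by
    refine fun s hs => mem_of_reach M hps π {s | M.dur (π r) ≤ (s : ℕ) ∧ (s : ℕ) ≤ r} ?_
      ⟨hdur, le_rfl⟩ hs
    rintro s ⟨hs1, hs2⟩
    rcases hs2.lt_or_eq with hlt | heq
    · simp only [Set.mem_ofPred_eq, step_coe_of_idle M π (hidle s hs1 hlt)]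
      omega
    · obtain rfl : s = r := Subtype.ext heq
      simp only [Set.mem_ofPred_eq, step_coe_of_ne_idle M π hr]
      omega
  have h := huni r top
    (fun s hs => reach_of_idle M hps π (hreach_r s hs).2
      fun x hx hxr => hidle x ((hreach_r s hs).1.trans hx) hxr)
    (fun s hs => by rw [hreach_top s hs]; exact reach_refl M hps π top)
  have := (hreach_r top h).2
  omega

/-- A unichain policy that solves the optimality equation and never takes the longer update on
the reduced state space is of switch type. -/
lemma isSwitchType_of_excess (hps : M.ps = 1) {a₁ a₂ : Action}
    (h₁ : a₁ ≠ .idle) (h₂ : a₂ ≠ .idle) (h₁₂ : a₁ ≠ a₂) (hL : M.dur a₁ ≤ M.dur a₂)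
    (θ : ℝ) (w : ℕ → ℝ) (hw : ∀ s ∈ Finset.Icc 1 M.maxAge, ∀ b, 0 ≤ M.excess θ w s b)
    (π : M.Policy) (hπ : ∀ s : M.State, M.excess θ w s (π s) = 0)
    (huni : M.IsUnichain π) (hne : ∀ s ∈ M.reducedStates, π s ≠ a₂) :
    M.IsSwitchType a₁ π := by
  classical
  have hmin := min_dur_eq M h₁ h₂ h₁₂ hL
  simp only [reducedStates, IsSwitchType, Set.mem_ofPred_eq, hmin] at hne ⊢
  have hor : ∀ s : M.State, M.dur a₁ ≤ s → π s ≠ .idle → π s = a₁ :=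
    fun s hs hi =>
    ((eq_idle_or_eq_or_eq h₁ h₂ h₁₂ (π s)).resolve_left hi).resolve_right (hne s hs)
  -- The threshold is the least reduced age at which the policy updates, if there is one.
  by_cases hex : ∃ n : ℕ, ∃ s : M.State, (s : ℕ) = n ∧ M.dur a₁ ≤ s ∧ π s = a₁
  swap
  · refine ⟨max (M.dur a₁) (M.maxAge + 1), le_max_left _ _, fun s hs => ⟨fun _ => ?_, fun h => ?_⟩⟩
    · by_contra hi
      exact hex ⟨s, s, rfl, hs, hor s hs hi⟩
    · have := (Finset.mem_Icc.mp s.2).2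
      omega
  obtain ⟨r, hrn, hrL, hra⟩ := Nat.find_spec hex
  have hbelow : ∀ s : M.State, M.dur a₁ ≤ s → (s : ℕ) < r → π s = .idle := by
    intro s hs hsr
    by_contra hi
    exact Nat.find_min hex (by omega) ⟨s, rfl, hs, hor s hs hi⟩
  have hrm := Finset.mem_Icc.mp r.2
  have htop : ∀ top : M.State, (top : ℕ) = M.maxAge → (r : ℕ) < top → π top ≠ .idle := by
    intro top ht hlt hi
    exact not_isUnichain_of_idle_of_update M hps π ht hi (hra ▸ h₁) hlt (hra ▸ hrL)
      (hra ▸ hbelow) huni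
  have hfix : ∀ n (h : n ∈ Finset.Icc 1 M.maxAge), (r : ℕ) ≤ n → π ⟨n, h⟩ = a₁ := by
    intro n h hrn
    induction n, hrn using Nat.le_induction with
    | base => exact hra
    | succ n hrn ih =>
      have hnm := Finset.mem_Icc.mp h
      have hn : n ∈ Finset.Icc 1 M.maxAge := Finset.mem_Icc.mpr ⟨by omega, by omega⟩
      have hna := ih hn
      by_contra hcon
      have hidle : π ⟨n + 1, h⟩ = .idle := by
        by_contra hi
        exact hcon (hor _ (show M.dur a₁ ≤ n + 1 by omega) hi)
      have hall : ∀ j (hj : j ∈ Finset.Icc 1 M.maxAge), n < j → π ⟨j, hj⟩ = .idle := by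
        intro j
        induction j using Nat.strong_induction_on with
        | _ j ih' =>
          intro hj hnj
          by_cases hj1 : j = n + 1
          · subst hj1
            exact hidle
          · have hjm := Finset.mem_Icc.mp hj
            have hpos := relValue_lt_of_idle M h₁ θ w hw (by omega : 1 ≤ n)
              (hna ▸ hπ ⟨n, hn⟩) (by omega : n + 1 < j) hjm.2 (fun i hni hij => by
                have hi : i ∈ Finset.Icc 1 M.maxAge := Finset.mem_Icc.mpr ⟨by omega, by omega⟩
                have := hπ ⟨i, hi⟩
                rwa [ih' i hij hi hni] at this)
            by_contra hi
            have h0 := hπ ⟨j, hj⟩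
            rw [hor ⟨j, hj⟩ (show M.dur a₁ ≤ j by omega) hi] at h0
            exact hpos.ne' h0
      have hm : M.maxAge ∈ Finset.Icc 1 M.maxAge := Finset.mem_Icc.mpr ⟨by omega, le_rfl⟩
      exact htop ⟨M.maxAge, hm⟩ rfl (show (r : ℕ) < M.maxAge by omega)
        (hall M.maxAge hm (by omega))
  exact ⟨r, hrL, fun s hs => ⟨hbelow s hs, fun h => hfix s s.2 h⟩⟩

/-! ### Construction of a solution -/

/-- The gain is chosen as large as possible, such that updating is nowhere better than idling on
from the age `N` that follows an update. -/
lemma exists_gain {N m : ℕ} (hNm : N ≤ m) {L c : ℝ} (hL : 1 ≤ L) :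
    ∃ θ : ℝ, θ ≤ m ∧
      (∀ s ∈ Finset.Icc N m, ∑ j ∈ Finset.Ico N s, (θ - j) ≤ L * (s - θ) + c) ∧
      (θ = m ∨ ∃ r ∈ Finset.Icc N m, ∑ j ∈ Finset.Ico N r, (θ - j) = L * (r - θ) + c) := by
  -- `A s / B s` is the average cost of the cycle that idles from `N` to `s` and then updates; each
  -- constraint reads `θ ≤ A s / B s`.
  set A : ℕ → ℝ := fun s => ∑ j ∈ Finset.Ico N s, (j : ℝ) + L * s + c with hA
  set B : ℕ → ℝ := fun s => ((s - N : ℕ) : ℝ) + L with hB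
  have hBpos : ∀ s, 0 < B s := fun s => by positivity
  have hsum : ∀ (θ : ℝ) (s : ℕ),
      ∑ j ∈ Finset.Ico N s, (θ - j) = θ * B s - A s + (L * (s - θ) + c) := by
    intro θ s
    rw [Finset.sum_sub_distrib, Finset.sum_const, Nat.card_Ico, nsmul_eq_mul, hA, hB]
    ring
  obtain ⟨r, hr, hmin⟩ := Finset.exists_min_image (Finset.Icc N m) (fun s => A s / B s)
    ⟨N, Finset.mem_Icc.mpr ⟨le_rfl, hNm⟩⟩
  refine ⟨min m (A r / B r), min_le_left _ _, fun s hs => ?_, ?_⟩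
  · have h := (min_le_right (m : ℝ) (A r / B r)).trans (hmin s hs)
    rw [le_div_iff₀ (hBpos s)] at h
    rw [hsum]
    linarith
  · rcases min_choice (m : ℝ) (A r / B r) with h | h
    · exact Or.inl h
    · refine Or.inr ⟨r, hr, ?_⟩
      rw [h, hsum, div_mul_cancel₀ _ (hBpos r).ne']
      ring

/-- Solution of the optimality equation above the age `N` that follows an update of duration `L`
and fixed cost `c`, for idling and this update only. -/
lemma exists_threshold_solution {N m : ℕ} (hNm : N ≤ m) {L c : ℝ} (hL : 1 ≤ L) :
    ∃ (θ : ℝ) (Ω : ℕ) (w : ℕ → ℝ), N ≤ Ω ∧ w N = 0 ∧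
      ∀ s ∈ Finset.Icc N m, 0 ≤ w s ∧
        0 ≤ L * (s - θ) + c - w s ∧
        0 ≤ s - θ + w (min (s + 1) m) - w s ∧
        (s < Ω → s - θ + w (min (s + 1) m) - w s = 0) ∧
        (Ω ≤ s → L * (s - θ) + c - w s = 0) := by
  obtain ⟨θ, hθm, hle, hcase⟩ := exists_gain hNm (c := c) hL
  -- The relative value forced by idling from `N`, normalized to vanish there.
  set G : ℕ → ℝ := fun s => ∑ j ∈ Finset.Ico N s, (θ - j) with hG
  have hGN : G N = 0 := by simp [hG]
  have hGs : ∀ s, N ≤ s → G (s + 1) = G s + (θ - s) := fun s hs =>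
    Finset.sum_Ico_succ_top hs _
  rcases hcase with hθ | ⟨r, hr, heq⟩
  · refine ⟨θ, m + 1, G, by omega, hGN, fun s hs => ?_⟩
    have hsm := Finset.mem_Icc.mp hs
    have hidle : (s : ℝ) - θ + G (min (s + 1) m) - G s = 0 := by
      rcases hsm.2.lt_or_eq with h | h
      · rw [min_eq_left (by omega), hGs s hsm.1]
        ring
      · rw [min_eq_right (by omega), h, hθ]
        ring
    refine ⟨Finset.sum_nonneg fun j hj => ?_, sub_nonneg.mpr (hle s hs), hidle.ge,
      fun _ => hidle, fun h => by omega⟩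
    have : (j : ℝ) ≤ m := by
      have := Finset.mem_Ico.mp hj
      exact_mod_cast (by omega : j ≤ m)
    linarith
  · have hrm := Finset.mem_Icc.mp hr
    -- Equality at `r` and the constraint at `r - 1` give `θ - (r - 1) ≥ L`.
    have hslope : ∀ j, N ≤ j → j < r → (j : ℝ) ≤ θ := by
      intro j hNj hjr
      obtain ⟨k, rfl⟩ : ∃ k, r = k + 1 := ⟨r - 1, by omega⟩
      have h1 := hle k (Finset.mem_Icc.mpr ⟨by omega, by omega⟩)
      have h2 := hGs k (by omega)
      have h3 : G (k + 1) = _ := heq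
      have h4 : G k ≤ _ := h1
      have : (j : ℝ) ≤ k := by exact_mod_cast (by omega : j ≤ k)
      push_cast at h3
      linarith
    have hGnonneg : ∀ s, s ≤ r → 0 ≤ G s := fun s hs => Finset.sum_nonneg fun j hj => by
      have := Finset.mem_Ico.mp hj
      have := hslope j (by omega) (by omega)
      linarith
    -- The constraint at `r + 1`; it makes idling no better than updating from `r` on.
    have hθr : r < m → θ - r ≤ L := by
      intro h
      have h1 := hle (r + 1) (Finset.mem_Icc.mpr ⟨by omega, by omega⟩)
      have h2 := hGs r hrm.1
      have h3 : G r = _ := heq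
      have h4 : G (r + 1) ≤ _ := h1
      push_cast at h4
      linarith
    set w : ℕ → ℝ := fun s => if s ≤ r then G s else L * (s - θ) + c with hw
    have hwl : ∀ s, s ≤ r → w s = G s := fun s hs => if_pos hs
    have hwr : ∀ s, r ≤ s → w s = L * (s - θ) + c := by
      intro s hs
      rcases hs.lt_or_eq with h | rfl
      · exact if_neg (by omega)
      · rw [hwl _ le_rfl]
        exact heq
    refine ⟨θ, r, w, hrm.1, (hwl N hrm.1).trans hGN, fun s hs => ?_⟩
    have hsm := Finset.mem_Icc.mp hs
    rcases lt_or_ge s r with h | h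
    · have hidle : (s : ℝ) - θ + w (min (s + 1) m) - w s = 0 := by
        rw [min_eq_left (by omega), hwl _ (by omega), hwl _ h.le, hGs s hsm.1]
        ring
      refine ⟨?_, ?_, hidle.ge, fun _ => hidle, fun h' => by omega⟩
      · rw [hwl s h.le]
        exact hGnonneg s h.le
      · rw [hwl s h.le]
        exact sub_nonneg.mpr (hle s hs)
    · have hrs : (r : ℝ) ≤ s := by exact_mod_cast h
      have hupd : L * (s - θ) + c - w s = 0 := by rw [hwr s h]; ring
      refine ⟨?_, hupd.ge, ?_, fun h' => by omega, fun _ => hupd⟩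
      · have h1 := hGnonneg r le_rfl
        rw [← hwl r le_rfl, hwr r le_rfl] at h1
        rw [hwr s h]
        nlinarith
      · rcases hsm.2.lt_or_eq with h' | h'
        · have := hθr (by omega)
          rw [min_eq_left (by omega), hwr s h, hwr (s + 1) (by omega)]
          push_cast
          linarith
        · rw [min_eq_right (by omega), h']
          linarith

/-- Downward extension of a function by the optimality equation. -/
lemma exists_downward_extension (N : ℕ) (w₀ u : ℕ → ℝ) (θ : ℝ) :
    ∃ w : ℕ → ℝ, (∀ s, N ≤ s → w s = w₀ s) ∧
      ∀ s, s < N → w s = min (u s) (s - θ + w (s + 1)) := by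
  induction N generalizing w₀ with
  | zero => exact ⟨w₀, fun _ _ => rfl, fun s hs => absurd hs (by omega)⟩
  | succ N ih =>
    obtain ⟨w, hw, hw'⟩ :=
      ih (Function.update w₀ N (min (u N) (N - θ + w₀ (N + 1))))
    have hs : ∀ s, N + 1 ≤ s → w s = w₀ s := fun s h => by
      rw [hw s (by omega), Function.update_of_ne (by omega)]
    refine ⟨w, hs, fun s h => ?_⟩
    rcases (Nat.lt_succ_iff.mp h).lt_or_eq with h' | rfl
    · exact hw' s h'
    · rw [hw s le_rfl, hs _ le_rfl, Function.update_self]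

/-- Solution of the optimality equation that is attained by a threshold policy. -/
lemma exists_relValue {a₁ a₂ : Action}
    (h₁ : a₁ ≠ .idle) (h₂ : a₂ ≠ .idle) (h₁₂ : a₁ ≠ a₂) (hL : M.dur a₁ ≤ M.dur a₂)
    (hC : M.energy a₁ / (M.dur a₁ : ℝ) ≤ M.energy a₂ / (M.dur a₂ : ℝ)) :
    ∃ (θ : ℝ) (Ω : ℕ) (w : ℕ → ℝ), min (M.dur a₁) M.maxAge ≤ Ω ∧
      ∀ s ∈ Finset.Icc 1 M.maxAge,
        (∀ a, 0 ≤ M.excess θ w s a) ∧ (∃ a, M.excess θ w s a = 0) ∧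
        (min (M.dur a₁) M.maxAge ≤ s →
          (s < Ω → M.excess θ w s .idle = 0) ∧ (Ω ≤ s → M.excess θ w s a₁ = 0)) := by
  set N := min (M.dur a₁) M.maxAge with hN
  set N₂ := min (M.dur a₂) M.maxAge with hN₂
  obtain ⟨θ, Ω, w₀, hΩ, hw₀N, hw₀⟩ := exists_threshold_solution (min_le_right _ _ : N ≤ M.maxAge)
    (c := M.fixedCost a₁) (M.one_le_dur a₁)
  -- Below `N`, updates lead to `N` or above and idling leads one age up, so the equation is a
  -- downward recursion.
  obtain ⟨w, hwN, hw⟩ := exists_downward_extension N w₀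
    (fun s => min (M.dur a₁ * ((s : ℝ) - θ) + M.fixedCost a₁ + w₀ N)
      (M.dur a₂ * ((s : ℝ) - θ) + M.fixedCost a₂ + w₀ N₂)) θ
  have hNN₂ : N ≤ N₂ := min_le_min_right _ hL
  have hN₂m : N₂ ≤ M.maxAge := min_le_right _ _
  have hw1 : w N = w₀ N := hwN N le_rfl
  have hw2 : w N₂ = w₀ N₂ := hwN N₂ hNN₂
  refine ⟨θ, Ω, w, hΩ, fun s hs => ?_⟩
  have hsm := Finset.mem_Icc.mp hs
  have e0 := M.excess_idle θ w s
  have e1 := M.excess_of_ne_idle θ w s h₁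
  have e2 := M.excess_of_ne_idle θ w s h₂
  rw [← hN, hw1] at e1
  rw [← hN₂, hw2] at e2
  rcases lt_or_ge s N with h | h
  · have hws := hw s h
    rw [min_eq_left (by omega)] at e0
    refine ⟨fun a => ?_, ?_, fun h' => by omega⟩
    · have i1 := hws.le.trans (min_le_right _ _)
      have i2 := (hws.le.trans (min_le_left _ _)).trans (min_le_left _ _)
      have i3 := (hws.le.trans (min_le_left _ _)).trans (min_le_right _ _)
      rcases eq_idle_or_eq_or_eq h₁ h₂ h₁₂ a with rfl | rfl | rfl <;> linarith
    · rcases min_choice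
        (min (M.dur a₁ * ((s : ℝ) - θ) + M.fixedCost a₁ + w₀ N)
          (M.dur a₂ * ((s : ℝ) - θ) + M.fixedCost a₂ + w₀ N₂)) (s - θ + w (s + 1)) with i | i
      · rcases min_choice (M.dur a₁ * ((s : ℝ) - θ) + M.fixedCost a₁ + w₀ N)
          (M.dur a₂ * ((s : ℝ) - θ) + M.fixedCost a₂ + w₀ N₂) with i' | i'
        · exact ⟨a₁, by linarith⟩
        · exact ⟨a₂, by linarith⟩
      · exact ⟨.idle, by linarith⟩
  · obtain ⟨hpos, hu, hi, hi0, hu0⟩ := hw₀ s (Finset.mem_Icc.mpr ⟨h, hsm.2⟩)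
    rw [hwN s h, hwN (min (s + 1) M.maxAge) (by omega)] at e0
    rw [hwN s h, hw₀N] at e1
    have f1 : 0 ≤ M.excess θ w s a₁ := by linarith
    -- The longer update played no part in `θ` and `w₀`; it is no better because `w` is nonnegative
    -- from `N` on and zero at `N`.
    have f2 : 0 ≤ M.excess θ w s a₂ := by
      have hd1 : (1 : ℝ) ≤ M.dur a₁ := M.one_le_dur a₁
      have hd2 : (1 : ℝ) ≤ M.dur a₂ := M.one_le_dur a₂
      have hL' : (M.dur a₁ : ℝ) ≤ M.dur a₂ := by exact_mod_cast hL
      have hpos₂ := (hw₀ N₂ (Finset.mem_Icc.mpr ⟨hNN₂, hN₂m⟩)).1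
      have key := M.excess_div_add_le hL hC θ w s
        (by rw [nextAge_of_ne_idle M s h₁, ← hN, hw1, hw₀N, hwN s h]; exact hpos)
        (by rw [nextAge_of_ne_idle M s h₁, nextAge_of_ne_idle M s h₂, ← hN, ← hN₂, hw1, hw2,
              hw₀N]; exact hpos₂)
      have := div_nonneg f1 (zero_le_one.trans hd1)
      have f3 : 0 ≤ M.excess θ w s a₂ / M.dur a₂ := by linarith
      by_contra hneg
      have := div_neg_of_neg_of_pos (not_le.mp hneg) (zero_lt_one.trans_le hd2)
      linarith
    have g0 : s < Ω → M.excess θ w s .idle = 0 := fun h' => by linarith [hi0 h']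
    have g1 : Ω ≤ s → M.excess θ w s a₁ = 0 := fun h' => by linarith [hu0 h']
    refine ⟨fun a => ?_, ?_, fun _ => ⟨g0, g1⟩⟩
    · rcases eq_idle_or_eq_or_eq h₁ h₂ h₁₂ a with rfl | rfl | rfl
      · linarith
      · exact f1
      · exact f2
    · rcases lt_or_ge s Ω with h' | h'
      · exact ⟨_, g0 h'⟩
      · exact ⟨_, g1 h'⟩

/-! ### The threshold policy and the existence statement -/

/-- A policy of threshold form above the age that follows the shorter update is unichain. -/
lemma isUnichain_of_threshold (hps : M.ps = 1) {a₁ a₂ : Action}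
    (h₁ : a₁ ≠ .idle) (h₂ : a₂ ≠ .idle) (h₁₂ : a₁ ≠ a₂) (hL : M.dur a₁ ≤ M.dur a₂)
    (π : M.Policy) (Ω : ℕ) (hΩ : min (M.dur a₁) M.maxAge ≤ Ω)
    (hπ : ∀ s : M.State, min (M.dur a₁) M.maxAge ≤ s →
      ((s : ℕ) < Ω → π s = .idle) ∧ (Ω ≤ (s : ℕ) → π s = a₁)) : M.IsUnichain π := by
  have hm := M.maxAge_pos
  have hd := M.dur_pos a₁
  set N := min (M.dur a₁) M.maxAge with hN
  -- Below `N`, idling climbs and either update lands at `N` or above.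
  have hcl : ∀ s : M.State, ∃ t : M.State, N ≤ (t : ℕ) ∧ M.Reach π s t := by
    intro s
    induction hk : N - (s : ℕ) using Nat.strong_induction_on generalizing s with
    | _ k ih =>
      rcases le_or_gt N s with h | h
      · exact ⟨s, h, reach_refl M hps π s⟩
      · by_cases hi : π s = .idle
        · have hst := step_coe_of_idle M π hi
          obtain ⟨t, ht, hr⟩ := ih _ (by omega) (M.step π s) rfl
          exact ⟨t, ht, Reach.trans M hps (reach_step M hps π s) hr⟩
        · refine ⟨_, ?_, reach_step M hps π s⟩
          rw [step_coe_of_ne_idle M π hi]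
          rcases eq_idle_or_eq_or_eq h₁ h₂ h₁₂ (π s) with h' | h' | h'
          · exact absurd h' hi
          · rw [h']
          · rw [h']
            exact min_le_min_right _ hL
  have hr : min Ω M.maxAge ∈ Finset.Icc 1 M.maxAge := Finset.mem_Icc.mpr ⟨by omega, by omega⟩
  have hNmem : N ∈ Finset.Icc 1 M.maxAge := Finset.mem_Icc.mpr ⟨by omega, by omega⟩
  refine isUnichain_of_reach M hps π ⟨min Ω M.maxAge, hr⟩ fun s => ?_
  have hup : ∀ t : M.State, N ≤ (t : ℕ) → (t : ℕ) ≤ min Ω M.maxAge →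
      M.Reach π t ⟨min Ω M.maxAge, hr⟩ := fun t ht hle =>
    reach_of_idle M hps π hle fun x hx hxr =>
      (hπ x (ht.trans hx)).1 (lt_of_lt_of_le hxr (min_le_left _ _))
  obtain ⟨t, ht, hst⟩ := hcl s
  refine Reach.trans M hps hst ?_
  rcases le_or_gt (t : ℕ) (min Ω M.maxAge) with h | h
  · exact hup t ht h
  · have htm := (Finset.mem_Icc.mp t.2).2
    have hta := (hπ t ht).2 (by omega)
    have hstep : M.step π t = ⟨N, hNmem⟩ := Subtype.ext (by
      rw [step_coe_of_ne_idle M π (hta ▸ h₁), hta])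
    exact Reach.trans M hps (hstep ▸ reach_step M hps π t) (hup _ le_rfl (by
      change N ≤ _
      omega))

lemma exists_optimal_switch (hps : M.ps = 1) {a₁ a₂ : Action}
    (h₁ : a₁ ≠ .idle) (h₂ : a₂ ≠ .idle) (h₁₂ : a₁ ≠ a₂) (hL : M.dur a₁ ≤ M.dur a₂)
    (hC : M.energy a₁ / (M.dur a₁ : ℝ) ≤ M.energy a₂ / (M.dur a₂ : ℝ))
    (ε : ℝ) (hε : 0 < ε) :
    ∃ (θ : ℝ) (V : M.State → ℝ) (π : M.Policy),
      M.IsBellmanSolution ε θ V ∧ M.IsUnichain π ∧ M.IsGreedy ε V π ∧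
        M.IsAvgOptimal π ∧ (∀ s : M.State, M.avgCost π s = θ) ∧ M.IsSwitchType a₁ π := by
  classical
  obtain ⟨θ, Ω, w, hΩ, hw⟩ := M.exists_relValue h₁ h₂ h₁₂ hL hC
  choose b hb using fun s : M.State => (hw s s.2).2.1
  let π : M.Policy := fun s =>
    if min (M.dur a₁) M.maxAge ≤ (s : ℕ) then (if (s : ℕ) < Ω then .idle else a₁) else b s
  have hπ : ∀ s : M.State, min (M.dur a₁) M.maxAge ≤ s →
      ((s : ℕ) < Ω → π s = .idle) ∧ (Ω ≤ (s : ℕ) → π s = a₁) := fun s hs =>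
    ⟨fun h => by simp only [π, if_pos hs, if_pos h],
      fun h => by simp only [π, if_pos hs, if_neg h.not_gt]⟩
  have hπ0 : ∀ s : M.State, M.excess θ w s (π s) = 0 := by
    intro s
    by_cases hs : min (M.dur a₁) M.maxAge ≤ (s : ℕ)
    · rcases lt_or_ge (s : ℕ) Ω with h | h
      · rw [(hπ s hs).1 h]
        exact ((hw s s.2).2.2 hs).1 h
      · rw [(hπ s hs).2 h]
        exact ((hw s s.2).2.2 hs).2 h
    · simp only [π, if_neg hs]
      exact hb s
  have hnonneg : ∀ (s : M.State) (a : Action), 0 ≤ M.excess θ w s a := fun s => (hw s s.2).1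
  have hV : ∀ s : M.State, w s = ε * (w s / ε) := fun s => (mul_div_cancel₀ _ hε.ne').symm
  have hB : M.IsBellmanSolution ε θ (fun s => w s / ε) :=
    (isBellmanSolution_iff M hps ε θ _ w hV).mpr fun s => ⟨hnonneg s, (hw s s.2).2.1⟩
  refine ⟨θ, fun s => w s / ε, π, hB, M.isUnichain_of_threshold hps h₁ h₂ h₁₂ hL π Ω hΩ hπ,
    (isGreedy_iff M hps ε θ _ w hV hB π).mpr hπ0,
    M.isAvgOptimal_of_excess hps θ w hnonneg π hπ0, M.avgCost_eq hps θ w π hπ0, ?_⟩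
  -- `Ω` is only known to exceed the truncated duration; raising it to `dur a₁` changes nothing on
  -- the reduced states.
  refine ⟨max Ω (M.dur a₁), ?_, fun s hs => ?_⟩
  · rw [min_dur_eq M h₁ h₂ h₁₂ hL]
    exact le_max_right _ _
  · have hs' : M.dur a₁ ≤ (s : ℕ) := by
      rw [← min_dur_eq M h₁ h₂ h₁₂ hL]
      exact hs
    have h := hπ s ((min_le_left _ _).trans hs')
    exact ⟨fun h' => h.1 (by omega), fun h' => h.2 (by omega)⟩

end Model

end StatusUpdate

theorem theorem4 (M : StatusUpdate.Model) (hps : M.ps = 1)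
    (a₁ a₂ : StatusUpdate.Action)
    (h₁ : a₁ ≠ StatusUpdate.Action.idle) (h₂ : a₂ ≠ StatusUpdate.Action.idle) (h₁₂ : a₁ ≠ a₂)
    (hL : M.dur a₁ ≤ M.dur a₂)
    (hC : M.energy a₁ / (M.dur a₁ : ℝ) ≤ M.energy a₂ / (M.dur a₂ : ℝ))
    (ε : ℝ) (hε : 0 < ε) (hε' : ∀ a, ε ≤ (M.dur a : ℝ)) :
    (∀ (θ : ℝ) (V : M.State → ℝ), M.IsBellmanSolution ε θ V →
      (∀ s ∈ M.reducedStates,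
        M.qval ε V s a₁ ≤ M.qval ε V s a₂ ∧
        (M.dur a₁ < M.dur a₂ → M.qval ε V s a₁ < M.qval ε V s a₂)) ∧
      (∀ π : M.Policy, M.IsUnichain π → M.IsGreedy ε V π →
        M.IsAvgOptimal π ∧
        (M.dur a₁ < M.dur a₂ → ∀ s ∈ M.reducedStates, π s ≠ a₂) ∧
        ((∀ s ∈ M.reducedStates, π s ≠ a₂) → M.IsSwitchType a₁ π))) ∧
    (∃ (θ : ℝ) (V : M.State → ℝ) (π : M.Policy),
      M.IsBellmanSolution ε θ V ∧ M.IsUnichain π ∧ M.IsGreedy ε V π ∧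
        M.IsAvgOptimal π ∧ (∀ s : M.State, M.avgCost π s = θ) ∧ M.IsSwitchType a₁ π) := by
  refine ⟨fun θ V hV => ?_, M.exists_optimal_switch hps h₁ h₂ h₁₂ hL hC ε hε⟩
  set w : ℕ → ℝ := M.ageExtend fun s => ε * V s with hw_def
  have hw : ∀ s : M.State, w s = ε * V s := M.ageExtend_coe _
  have hB := (M.isBellmanSolution_iff hps ε θ V w hw).mp hV
  have hB' : ∀ s ∈ Finset.Icc 1 M.maxAge,
      (∀ a, 0 ≤ M.excess θ w s a) ∧ ∃ a, M.excess θ w s a = 0 := fun s hs => hB ⟨s, hs⟩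
  have hL' : (M.dur a₁ : ℝ) ≤ M.dur a₂ := by exact_mod_cast hL
  have hq : ∀ s ∈ M.reducedStates,
      M.qval ε V s a₁ + ((M.dur a₂ : ℝ) - M.dur a₁) / 2 ≤ M.qval ε V s a₂ := by
    intro s hs
    have hs' : M.dur a₁ ≤ (s : ℕ) := by
      rw [← M.min_dur_eq h₁ h₂ h₁₂ hL]
      exact hs
    have hn₁ := M.nextAge_of_ne_idle s h₁
    have hn₂ := M.nextAge_of_ne_idle s h₂
    have hm₁ := Finset.mem_Icc.mp (M.nextAge_mem s a₁)
    have hm₂ := Finset.mem_Icc.mp (M.nextAge_mem s a₂)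
    -- On the reduced states the age after the shorter update is at most `s`, so monotonicity
    -- supplies both hypotheses.
    have key := M.excess_div_add_le hL hC θ w s
      (M.relValue_mono θ w hB' hm₁.1 (by omega) (Finset.mem_Icc.mp s.2).2)
      (M.relValue_mono θ w hB' hm₁.1 (by omega) hm₂.2)
    rw [M.qval_eq hps ε θ V w hw, M.qval_eq hps ε θ V w hw]
    linarith
  have hstrict : M.dur a₁ < M.dur a₂ → ∀ s ∈ M.reducedStates,
      M.qval ε V s a₁ < M.qval ε V s a₂ := by
    intro hlt s hs
    have : (M.dur a₁ : ℝ) < M.dur a₂ := by exact_mod_cast hlt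
    have := hq s hs
    linarith
  refine ⟨fun s hs => ⟨?_, fun hlt => hstrict hlt s hs⟩, fun π huni hgreedy => ?_⟩
  · have := hq s hs
    linarith
  have hπ := (M.isGreedy_iff hps ε θ V w hw hV π).mp hgreedy
  refine ⟨M.isAvgOptimal_of_excess hps θ w (fun s => (hB s).1) π hπ, fun hlt s hs heq => ?_,
    M.isSwitchType_of_excess hps h₁ h₂ h₁₂ hL θ w (fun s hs => (hB' s hs).1) π hπ huni⟩
  have h := hgreedy s a₁
  rw [heq] at h
  exact (hstrict hlt s hs).not_ge h
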